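/- Let $\mathcal G$ be a compact star graph with central vertex $v$ and edges $e_1,\dots,e_n$, where $e_j=[v,v_j]$ is identified with a bounded interval $[0,\ell_j]$, $\ell_j>0$ ($v$ corresponding to $0$ and the outer vertex $v_j$ to $\ell_j$). For each $j$ let $p_j,q_j\in L^1(e_j,\mathbb R)$, $\alpha_j\in[0,\pi)$, and let $$H_j\boldsymbol f_j=-J\boldsymbol f_j'+V_j\boldsymbol f_j,\qquad J=\begin{pmatrix}0&-1\\1&0\end{pmatrix},\qquad V_j=\begin{pmatrix}p_j&q_j\\q_j&-p_j\end{pmatrix},\qquad \boldsymbol f_j=\begin{pmatrix}f_j\\ \widehat f_j\end{pmatrix},$$ be the Dirac-Krein differential expression on $e_j$. For $\tau\in\mathbb R\cup\{\pm\infty\}$ let $\mathcal T_\tau$ be the operator $(\boldsymbol f_j)_{j=1}^n\mapsto(H_j\boldsymbol f_j)_{j=1}^n$ in the Hilbert space $\bigoplus_{j=1}^n L^2(e_j;\mathbb C^2)$ whose domain consists of all $(\boldsymbol f_j)_{j=1}^n$ such that each $\boldsymbol f_j$ is absolutely continuous on $e_j$ with $H_j\boldsymbol f_j\in L^2(e_j;\mathbb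 C^2)$ and $\cos\alpha_j\,f_j(v_j)+\sin\alpha_j\,\widehat f_j(v_j)=0$, and such that the Robin matching conditions $$f_1(v)=f_2(v)=\dots=f_n(v),\qquad f_1(v)=\tau\big(\widehat f_1(v)+\widehat f_2(v)+\dots+\widehat f_n(v)\big)$$ hold at the central vertex; for $\tau=\pm\infty$ the second condition is read as $\widehat f_1(v)+\dots+\widehat f_n(v)=0$. An eigenvalue $\lambda$ of $\mathcal T_\tau$ is called multiple if $\dim\ker(\mathcal T_\tau-\lambda)\ge 2$, and two real eigenvalues $a<b$ of $\mathcal T_\tau$ are called consecutive if there is no eigenvalue of $\mathcal T_\tau$ in the open interval $(a,b)$. If $\tau\neq 0$, then two consecutive eigenvalues of $\mathcal T_\tau$ cannot both be multiple. -/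

import Mathlib

open MeasureTheory

namespace DiracKrein

/-- The space `ℂ²` of values `(f, f̂)ᵗ` of a vector function on an edge:
index `0` is `f`, index `1` is `f̂`. -/
abbrev C2 : Type := EuclideanSpace ℂ (Fin 2)

/-- The matrix `J`. -/
def J : Matrix (Fin 2) (Fin 2) ℂ := !![0, -1; 1, 0]

/-- The potential matrix with real entries `p`, `q`. -/
def V (p q : ℝ) : Matrix (Fin 2) (Fin 2) ℂ := !![(p : ℂ), (q : ℂ); (q : ℂ), -(p : ℂ)]

/-- The Dirac-Krein differential expression `H u = -J u' + V u`. For an absolutely continuous `u`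
the derivative exists almost everywhere. -/
noncomputable def H (p q : ℝ → ℝ) (u : ℝ → C2) (x : ℝ) : C2 :=
  -(Matrix.toEuclideanLin J (deriv u x)) + Matrix.toEuclideanLin (V (p x) (q x)) (u x)

/-- Lebesgue measure on the edge `[0, l]`. -/
noncomputable abbrev edgeMeasure (l : ℝ) : Measure ℝ := volume.restrict (Set.Icc 0 l)

end DiracKrein

/-- The data of a Dirac-Krein system on a compact star graph with `n` edges. The edge `j` is
identified with `[0, len j]`, where `0` is the central vertex `v` and `len j` the outer vertex
`v_j`. -/
structure DiracKreinStar (n : ℕ) where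
  /-- edge lengths -/
  len : Fin n → ℝ
  len_pos : ∀ j, 0 < len j
  /-- potentials -/
  p : Fin n → ℝ → ℝ
  q : Fin n → ℝ → ℝ
  p_int : ∀ j, IntegrableOn (p j) (Set.Icc 0 (len j))
  q_int : ∀ j, IntegrableOn (q j) (Set.Icc 0 (len j))
  /-- parameters of the boundary conditions at the outer vertices -/
  α : Fin n → ℝ
  α_mem : ∀ j, α j ∈ Set.Ico 0 Real.pi

namespace DiracKreinStar

open DiracKrein

variable {n : ℕ}

/-- The Hilbert space `L²(𝒢)`, the orthogonal sum of the spaces `L²([0, len j]; ℂ²)`. -/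
abbrev L2 (G : DiracKreinStar n) : Type :=
  PiLp 2 (fun j : Fin n => Lp C2 2 (edgeMeasure (G.len j)))

/-- The maximal domain on the edge `j`, in terms of absolutely continuous representatives: `u` is
absolutely continuous, `H u` is square integrable, and `u` satisfies the boundary condition
`cos α_j u + sin α_j û = 0` at the outer vertex. -/
structure MemMaxDomain (G : DiracKreinStar n) (j : Fin n) (u : ℝ → C2) : Prop where
  ac : AbsolutelyContinuousOnInterval u 0 (G.len j)
  memLp : MemLp (H (G.p j) (G.q j) u) 2 (edgeMeasure (G.len j))
  outer : (Real.cos (G.α j) : ℂ) * u (G.len j) 0 + (Real.sin (G.α j) : ℂ) * u (G.len j) 1 = 0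

/-- The Robin matching conditions with parameter `τ ∈ ℝ ∪ {±∞}` for the values
`w j = (f_j(v), f̂_j(v))` at the central vertex: all `f_j(v)` are equal, and
`f_j(v) = τ ∑ k, f̂_k(v)`, which for `τ = ±∞` is read as `∑ k, f̂_k(v) = 0`. -/
structure RobinMatching (τ : EReal) (w : Fin n → C2) : Prop where
  eq : ∀ i j, w i 0 = w j 0
  finite : ∀ t : ℝ, τ = (t : EReal) → ∀ j, w j 0 = (t : ℂ) * ∑ k, w k 1
  infinite : τ = ⊤ ∨ τ = ⊥ → ∑ k, w k 1 = 0

lemma H_add {p q : ℝ → ℝ} {l : ℝ} (hl : 0 < l) {u w : ℝ → C2}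
    (hu : AbsolutelyContinuousOnInterval u 0 l) (hw : AbsolutelyContinuousOnInterval w 0 l) :
    H p q (u + w) =ᵐ[edgeMeasure l] H p q u + H p q w := by
  have h1 := hu.boundedVariationOn.ae_differentiableAt_of_mem_uIcc
  have h2 := hw.boundedVariationOn.ae_differentiableAt_of_mem_uIcc
  rw [Filter.EventuallyEq, ae_restrict_iff' measurableSet_Icc]
  filter_upwards [h1, h2] with x hx1 hx2 hx
  rw [Set.uIcc_of_le hl.le] at hx1 hx2
  simp only [H, Pi.add_apply, deriv_add (hx1 hx) (hx2 hx), map_add]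
  abel

lemma H_smul {p q : ℝ → ℝ} {l : ℝ} (hl : 0 < l) {u : ℝ → C2} (c : ℂ)
    (hu : AbsolutelyContinuousOnInterval u 0 l) :
    H p q (c • u) =ᵐ[edgeMeasure l] c • H p q u := by
  have h1 := hu.boundedVariationOn.ae_differentiableAt_of_mem_uIcc
  rw [Filter.EventuallyEq, ae_restrict_iff' measurableSet_Icc]
  filter_upwards [h1] with x hx1 hx
  rw [Set.uIcc_of_le hl.le] at hx1
  simp only [H, Pi.smul_apply, deriv_const_smul c (hx1 hx), map_smul, smul_add, smul_neg]

lemma MemMaxDomain.add {G : DiracKreinStar n} {j : Fin n} {u w : ℝ → C2}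
    (hu : G.MemMaxDomain j u) (hw : G.MemMaxDomain j w) : G.MemMaxDomain j (u + w) where
  ac := hu.ac.add hw.ac
  memLp := (memLp_congr_ae (H_add (G.len_pos j) hu.ac hw.ac)).mpr (hu.memLp.add hw.memLp)
  outer := by
    have h1 := hu.outer
    have h2 := hw.outer
    simp only [Pi.add_apply, PiLp.add_apply]
    linear_combination h1 + h2

lemma MemMaxDomain.smul {G : DiracKreinStar n} {j : Fin n} {u : ℝ → C2} (c : ℂ)
    (hu : G.MemMaxDomain j u) : G.MemMaxDomain j (c • u) where
  ac := hu.ac.const_smul c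
  memLp := (memLp_congr_ae (H_smul (G.len_pos j) c hu.ac)).mpr (hu.memLp.const_smul c)
  outer := by
    have h1 := hu.outer
    simp only [Pi.smul_apply, PiLp.smul_apply, smul_eq_mul]
    linear_combination c * h1

lemma MemMaxDomain.zero (G : DiracKreinStar n) (j : Fin n) : G.MemMaxDomain j 0 := by
  have hH : H (G.p j) (G.q j) 0 = 0 := by
    funext x
    have : deriv (0 : ℝ → C2) x = 0 := by
      have h := deriv_const x (0 : C2)
      exact h
    simp [H, this]
  refine ⟨?_, ?_, by simp⟩
  · have : LipschitzOnWith 0 (0 : ℝ → C2) (Set.uIcc 0 (G.len j)) :=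
      (LipschitzWith.const (0 : C2)).lipschitzOnWith
    exact this.absolutelyContinuousOnInterval
  · rw [hH]
    exact MemLp.zero

/-- The graph of `𝒯_τ`: the pairs `(f, H f)` where `f` has absolutely continuous representatives
in the maximal domains of the edges which satisfy the Robin matching conditions at the central
vertex. -/
noncomputable def robinGraph (G : DiracKreinStar n) (τ : EReal) : Submodule ℂ (G.L2 × G.L2) where
  carrier := {fg | ∃ u : Fin n → ℝ → C2,
    (∀ j, G.MemMaxDomain j (u j)) ∧ RobinMatching τ (fun j => u j 0) ∧
    (∀ j, fg.1 j =ᵐ[edgeMeasure (G.len j)] u j) ∧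
    (∀ j, fg.2 j =ᵐ[edgeMeasure (G.len j)] H (G.p j) (G.q j) (u j))}
  add_mem' := by
    rintro ⟨f, g⟩ ⟨f', g'⟩ ⟨u, hu, ru, hf, hg⟩ ⟨u', hu', ru', hf', hg'⟩
    refine ⟨u + u', fun j => (hu j).add (hu' j), ⟨?_, ?_, ?_⟩, fun j => ?_, fun j => ?_⟩
    · intro i j
      have h1 := ru.eq i j
      have h2 := ru'.eq i j
      simp only [Pi.add_apply, PiLp.add_apply] at *
      rw [h1, h2]
    · intro t ht j
      have h1 := ru.finite t ht j
      have h2 := ru'.finite t ht j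
      simp only [Pi.add_apply, PiLp.add_apply, Finset.sum_add_distrib] at *
      rw [h1, h2]
      ring
    · intro ht
      have h1 := ru.infinite ht
      have h2 := ru'.infinite ht
      simp only [Pi.add_apply, PiLp.add_apply, Finset.sum_add_distrib] at *
      rw [h1, h2, add_zero]
    · exact (Lp.coeFn_add (f j) (f' j)).trans ((hf j).add (hf' j))
    · exact ((Lp.coeFn_add (g j) (g' j)).trans ((hg j).add (hg' j))).trans
        (H_add (G.len_pos j) (hu j).ac (hu' j).ac).symm
  zero_mem' := by
    refine ⟨0, fun j => MemMaxDomain.zero G j, ⟨?_, ?_, ?_⟩, fun j => ?_, fun j => ?_⟩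
    · simp
    · simp
    · simp
    · exact Lp.coeFn_zero _ _ _
    · refine (Lp.coeFn_zero _ _ _).trans ?_
      have h := H_smul (p := G.p j) (q := G.q j) (G.len_pos j) (0 : ℂ) (MemMaxDomain.zero G j).ac
      simp only [zero_smul] at h
      exact h.symm
  smul_mem' := by
    rintro c ⟨f, g⟩ ⟨u, hu, ru, hf, hg⟩
    refine ⟨c • u, fun j => (hu j).smul c, ⟨?_, ?_, ?_⟩, fun j => ?_, fun j => ?_⟩
    · intro i j
      have h1 := ru.eq i j
      simp only [Pi.smul_apply, PiLp.smul_apply] at *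
      rw [h1]
    · intro t ht j
      have h1 := ru.finite t ht j
      simp only [Pi.smul_apply, PiLp.smul_apply, smul_eq_mul, ← Finset.mul_sum] at *
      rw [h1]
      ring
    · intro ht
      have h1 := ru.infinite ht
      simp only [Pi.smul_apply, PiLp.smul_apply, smul_eq_mul, ← Finset.mul_sum] at *
      rw [h1, mul_zero]
    · exact (Lp.coeFn_smul c (f j)).trans ((hf j).const_smul c)
    · exact ((Lp.coeFn_smul c (g j)).trans ((hg j).const_smul c)).trans
        (H_smul (G.len_pos j) c (hu j).ac).symm

/-- The operator `𝒯_τ` in `L²(𝒢)`: it maps `f` in its domain to `(H_j f_j)_j`. -/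
noncomputable def T (G : DiracKreinStar n) (τ : EReal) : G.L2 →ₗ.[ℂ] G.L2 :=
  (G.robinGraph τ).toLinearPMap

lemma H_eq_zero_of_ae {p q : ℝ → ℝ} {l : ℝ} (hl : 0 < l) {u : ℝ → C2}
    (hu : AbsolutelyContinuousOnInterval u 0 l) (h0 : u =ᵐ[edgeMeasure l] 0) :
    H p q u =ᵐ[edgeMeasure l] 0 := by
  have hc : ContinuousOn u (Set.Icc 0 l) := by
    have := hu.continuousOn
    rwa [Set.uIcc_of_le hl.le] at this
  have hz : Set.EqOn u 0 (Set.Icc 0 l) :=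
    Measure.eqOn_Icc_of_ae_eq volume hl.ne h0 hc continuousOn_const
  rw [Filter.EventuallyEq, edgeMeasure, ← Measure.restrict_congr_set Ioo_ae_eq_Icc,
    ae_restrict_iff' measurableSet_Ioo]
  refine Filter.Eventually.of_forall fun x hx => ?_
  have he : u =ᶠ[nhds x] fun _ => (0 : C2) := by
    filter_upwards [Ioo_mem_nhds hx.1 hx.2] with y hy
    exact hz (Set.Ioo_subset_Icc_self hy)
  have hd : deriv u x = 0 := by
    rw [he.deriv_eq]
    exact deriv_const x (0 : C2)
  simp [H, hd, he.eq_of_nhds]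

/-- `robinGraph` is single valued, so it is the graph of `𝒯_τ`. -/
theorem T_graph (G : DiracKreinStar n) (τ : EReal) : (G.T τ).graph = G.robinGraph τ := by
  refine Submodule.toLinearPMap_graph_eq _ ?_
  rintro ⟨f, g⟩ ⟨u, hu, -, hf, hg⟩ (rfl : f = 0)
  ext1 j
  refine Lp.ext ((hg j).trans ?_)
  refine (H_eq_zero_of_ae (G.len_pos j) (hu j).ac ?_).trans (Lp.coeFn_zero _ _ _).symm
  exact (hf j).symm.trans (Lp.coeFn_zero _ _ _)

/-- The domain of `𝒯_τ`. -/
theorem mem_domain_T (G : DiracKreinStar n) (τ : EReal) (f : G.L2) :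
    f ∈ (G.T τ).domain ↔ ∃ u : Fin n → ℝ → C2,
      (∀ j, G.MemMaxDomain j (u j)) ∧ RobinMatching τ (fun j => u j 0) ∧
      (∀ j, f j =ᵐ[edgeMeasure (G.len j)] u j) := by
  rw [LinearPMap.mem_domain_iff, T_graph]
  constructor
  · rintro ⟨g, u, hu, ru, hf, -⟩
    exact ⟨u, hu, ru, hf⟩
  · rintro ⟨u, hu, ru, hf⟩
    exact ⟨WithLp.toLp 2 fun j => (hu j).memLp.toLp _, u, hu, ru, hf,
      fun j => (hu j).memLp.coeFn_toLp⟩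

end DiracKreinStar

namespace LinearPMap

variable {E : Type*} [AddCommGroup E] [Module ℂ E]

/-- The kernel `ker (T - z)` of a partially defined operator `T`. -/
def pointEigenspace (T : E →ₗ.[ℂ] E) (z : ℂ) : Submodule ℂ E :=
  (LinearMap.ker (T.toFun - z • T.domain.subtype)).map T.domain.subtype

/-- `z` belongs to the point spectrum of `T`. -/
def IsEigenvalue (T : E →ₗ.[ℂ] E) (z : ℂ) : Prop := T.pointEigenspace z ≠ ⊥

/-- `z` is a multiple eigenvalue of `T`: its multiplicity `dim ker (T - z)` is at least two. -/
def IsMultipleEigenvalue (T : E →ₗ.[ℂ] E) (z : ℂ) : Prop :=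
  2 ≤ Module.rank ℂ (T.pointEigenspace z)

/-- `a < b` are consecutive (real) eigenvalues of `T`: both are eigenvalues, and there is no
eigenvalue strictly between them. -/
structure AreConsecutiveEigenvalues (T : E →ₗ.[ℂ] E) (a b : ℝ) : Prop where
  lt : a < b
  left : T.IsEigenvalue a
  right : T.IsEigenvalue b
  between : ∀ c : ℝ, a < c → c < b → ¬ T.IsEigenvalue c

theorem mem_pointEigenspace_iff (T : E →ₗ.[ℂ] E) (z : ℂ) (x : E) :
    x ∈ T.pointEigenspace z ↔ (x, z • x) ∈ T.graph := by
  simp only [pointEigenspace, Submodule.mem_map, LinearMap.mem_ker, LinearMap.sub_apply,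
    sub_eq_zero, LinearPMap.mem_graph_iff, LinearMap.smul_apply, Submodule.subtype_apply]
  constructor
  · rintro ⟨y, hy, rfl⟩
    exact ⟨y, rfl, hy⟩
  · rintro ⟨y, hy, h⟩
    obtain rfl : (y : E) = x := hy
    exact ⟨y, h, rfl⟩

end LinearPMap

/-! On each edge and for each real `r` there is a real solution `(F r, G r)` with outer values `(sin
α, -cos α)`, and every complex solution obeying the outer condition is a multiple of it. The
argument rests on the Weyl functions `m_j(r) = G r 0 / F r 0` and their sum `M`.

If no `F r 0` vanishes, the common value of the `f_j` at the centre fixes the multiple on every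
edge, so the eigenspace has dimension at most one. A multiple eigenvalue is therefore a pole of some
`m_j` (`exists_fst_eq_zero_of_isMultipleEigenvalue`).

At a zero `r` of `F · 0` the Lagrange identity gives `G r 0 * F s 0 = (s - r) * I s` with `I`
continuous and `I r > 0`. Each pole thus behaves like a positive multiple of `1 / (s - r)`: `+∞`
from the right, `-∞` from the left (`OuterFamily.tendsto_div_of_fst_eq_zero`). These signs agree on
all edges, so poles cannot cancel in `M`, and `M` takes every real value strictly between two poles
(`exists_sum_div_eq`).

If `a < b` are both multiple, `M` attains `1/τ` (or `0` when `τ = ±∞`) at a non-pole `c` between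
them. The solutions with central values `(1, m_j(c))` then form an eigenfunction for `c`, so `a` and
`b` are not consecutive. -/

section Volterra

open Set intervalIntegral

/-! ### Absolute continuity and Volterra operators with integrable kernels. -/

lemma AbsolutelyContinuousOnInterval.lipschitz_comp {X Y : Type*} [PseudoMetricSpace X]
    [PseudoMetricSpace Y] {f : ℝ → X} {a b : ℝ} {K : NNReal} {g : X → Y}
    (hg : LipschitzWith K g) (hf : AbsolutelyContinuousOnInterval f a b) :
    AbsolutelyContinuousOnInterval (fun x => g (f x)) a b := by
  refine squeeze_zero (fun E => Finset.sum_nonneg fun i _ => dist_nonneg) (fun E => ?_)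
    (by simpa using Filter.Tendsto.const_mul (K : ℝ) hf)
  rw [Finset.mul_sum]
  exact Finset.sum_le_sum fun i _ => hg.dist_le_mul _ _

lemma AbsolutelyContinuousOnInterval.const_add {f : ℝ → ℝ} {a b : ℝ} (c : ℝ)
    (hf : AbsolutelyContinuousOnInterval f a b) :
    AbsolutelyContinuousOnInterval (fun x => c + f x) a b := by
  have h : LipschitzWith 1 (fun y : ℝ => c + y) := LipschitzWith.of_dist_le_mul (by simp)
  exact hf.lipschitz_comp h

lemma AbsolutelyContinuousOnInterval.pow {f : ℝ → ℝ} {a b : ℝ}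
    (hf : AbsolutelyContinuousOnInterval f a b) (n : ℕ) :
    AbsolutelyContinuousOnInterval (fun x => f x ^ (n + 1)) a b := by
  induction n with
  | zero => simpa using hf
  | succ n ih => simpa only [pow_succ _ (n + 1)] using ih.fun_mul hf

/-- The iterated integral of a density against the powers of its primitive. -/
lemma integral_mul_primitive_pow {a : ℝ → ℝ} {x l : ℝ} (ha : IntervalIntegrable a volume x l)
    (n : ℕ) :
    ∫ t in x..l, a t * (∫ s in t..l, a s) ^ n = (∫ s in x..l, a s) ^ (n + 1) / (n + 1) := by
  have hS : AbsolutelyContinuousOnInterval (fun t => ∫ s in l..t, a s) x l :=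
    ha.absolutelyContinuousOnInterval_intervalIntegral right_mem_uIcc
  have hneg : AbsolutelyContinuousOnInterval (fun t => ∫ s in t..l, a s) x l := by
    convert hS.const_mul (-1) using 2 with t
    rw [integral_symm, neg_one_mul]
  have hpow := (hneg.pow n).integral_deriv_eq_sub
  have hd : ∀ᵐ t, t ∈ uIoc x l → deriv (fun t => (∫ s in t..l, a s) ^ (n + 1)) t
      = (-(n + 1 : ℝ)) * (a t * (∫ s in t..l, a s) ^ n) := by
    filter_upwards [ha.ae_hasDerivAt_integral] with t ht htm
    have h1 := (ht (uIoc_subset_uIcc htm) l right_mem_uIcc).neg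
    have h2 : HasDerivAt (fun t => ∫ s in t..l, a s) (-a t) t := by
      refine h1.congr_of_eventuallyEq (Filter.Eventually.of_forall fun y => ?_)
      simp [integral_symm y l]
    rw [(h2.fun_pow (n + 1)).deriv]
    push_cast
    ring
  rw [integral_congr_ae hd, intervalIntegral.integral_const_mul] at hpow
  have hn : (n + 1 : ℝ) ≠ 0 := by positivity
  rw [eq_div_iff hn]
  simp at hpow
  linarith

variable {E : Type*} [NormedAddCommGroup E] [NormedSpace ℝ E]

/-- `projIcc` extends `u` to a bounded continuous function on the line, and a bounded factor
preserves integrability. -/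
lemma integrable_apply_projIcc {A : ℝ → E →L[ℝ] E} (hA : Integrable A) {l : ℝ} (hl : 0 ≤ l)
    (u : C(Icc 0 l, E)) : Integrable fun t => A t (u (projIcc 0 l hl t)) := by
  refine (hA.norm.mul_const ‖u‖).mono' ?_ (Filter.Eventually.of_forall fun t => ?_)
  · exact isBoundedBilinearMap_apply.continuous.comp_aestronglyMeasurable₂ hA.1
      (u.continuous.comp continuous_projIcc).aestronglyMeasurable
  · exact (A t).le_opNorm_of_le (u.norm_coe_le_norm _)

/-- The Volterra operator `u ↦ ∫ t in l..x, A t (u t)` on the continuous functions on `[0, l]`. -/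
noncomputable def volterra (A : ℝ → E →L[ℝ] E) (hA : Integrable A) {l : ℝ} (hl : 0 ≤ l) :
    C(Icc 0 l, E) →L[ℝ] C(Icc 0 l, E) :=
  LinearMap.mkContinuous
    { toFun := fun u => ⟨fun x => ∫ t in l..x, A t (u (projIcc 0 l hl t)),
        (continuous_primitive
          (fun _ _ => (integrable_apply_projIcc hA hl u).intervalIntegrable) l).comp
          continuous_subtype_val⟩
      map_add' := fun u w => by
        ext x
        simp only [ContinuousMap.coe_mk, ContinuousMap.add_apply, map_add]
        exact integral_add (integrable_apply_projIcc hA hl u).intervalIntegrable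
          (integrable_apply_projIcc hA hl w).intervalIntegrable
      map_smul' := fun c u => by
        ext x
        simp }
    (∫ t, ‖A t‖) fun u => by
      refine (ContinuousMap.norm_le _ (by positivity)).2 fun x => ?_
      refine norm_integral_le_integral_norm_uIoc.trans ?_
      rw [← MeasureTheory.integral_mul_const]
      refine (setIntegral_le_integral (integrable_apply_projIcc hA hl u).norm
        (Filter.Eventually.of_forall fun t => norm_nonneg _)).trans ?_
      exact integral_mono (integrable_apply_projIcc hA hl u).norm (hA.norm.mul_const _)
        fun t => (A t).le_opNorm_of_le (u.norm_coe_le_norm _)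

lemma volterra_apply {A : ℝ → E →L[ℝ] E} (hA : Integrable A) {l : ℝ} (hl : 0 ≤ l)
    (u : C(Icc 0 l, E)) (x : Icc 0 l) :
    volterra A hA hl u x = ∫ t in l..x, A t (u (projIcc 0 l hl t)) := rfl

/-- With `B` the rotation, this makes the operator of the system affine in the spectral parameter,
hence norm continuous in it. -/
lemma volterra_add_smul {A B : ℝ → E →L[ℝ] E} (hA : Integrable A) (hB : Integrable B) {l : ℝ}
    (hl : 0 ≤ l) (c : ℝ) :
    volterra (fun t => A t + c • B t) (hA.add (hB.smul c)) hl
      = volterra A hA hl + c • volterra B hB hl := by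
  ext u x
  simp only [_root_.add_apply, _root_.smul_apply,
    ContinuousMap.add_apply, ContinuousMap.smul_apply, volterra_apply]
  rw [← intervalIntegral.integral_smul]
  exact intervalIntegral.integral_add (integrable_apply_projIcc hA hl u).intervalIntegrable
    ((integrable_apply_projIcc hB hl u).smul c).intervalIntegrable

/-- Each application integrates the previous bound against `‖A‖`, and the iterated integral of a
density against powers of its primitive produces the factorial. The operator need not be a
contraction, but its powers eventually are. -/
lemma norm_volterra_pow_apply_le {A : ℝ → E →L[ℝ] E} (hA : Integrable A) {l : ℝ} (hl : 0 ≤ l)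
    (n : ℕ) (u : C(Icc 0 l, E)) (x : Icc 0 l) :
    ‖(volterra A hA hl ^ n) u x‖ ≤ (∫ t in (x : ℝ)..l, ‖A t‖) ^ n / n.factorial * ‖u‖ := by
  induction n generalizing x with
  | zero => simpa using u.norm_coe_le_norm x
  | succ n ih =>
    have hi : ∀ c d, IntervalIntegrable (fun t => ‖A t‖) volume c d :=
      fun c d => hA.norm.intervalIntegrable
    have hc : Continuous fun t => (∫ s in t..l, ‖A s‖) := by
      refine (continuous_primitive hi l).neg.congr fun t => ?_
      rw [Pi.neg_apply, integral_symm, neg_neg]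
    rw [pow_succ', mul_apply_eq_comp, volterra_apply, integral_symm, norm_neg]
    calc ‖∫ t in (x : ℝ)..l, A t ((volterra A hA hl ^ n) u (projIcc 0 l hl t))‖
        ≤ ∫ t in (x : ℝ)..l,
            ‖A t‖ * (∫ s in t..l, ‖A s‖) ^ n * (‖u‖ / n.factorial) := by
          refine norm_integral_le_of_norm_le x.2.2
            (Filter.Eventually.of_forall fun t ht => ?_)
            (((hi _ _).mul_continuousOn (hc.pow n).continuousOn).mul_const _)
          have := ih (projIcc 0 l hl t)
          rw [projIcc_of_mem hl ⟨x.2.1.trans ht.1.le, ht.2⟩] at this ⊢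
          refine ((A t).le_opNorm_of_le this).trans (le_of_eq ?_)
          ring
      _ = _ := by
          rw [intervalIntegral.integral_mul_const, integral_mul_primitive_pow (hi _ _)]
          rw [Nat.factorial_succ]
          push_cast
          field_simp

lemma isUnit_one_sub_volterra {A : ℝ → E →L[ℝ] E} [CompleteSpace E] (hA : Integrable A) {l : ℝ}
    (hl : 0 ≤ l) : IsUnit (1 - volterra A hA hl) := by
  set M := ∫ t, ‖A t‖
  obtain ⟨n, hn⟩ := ((FloorSemiring.tendsto_pow_div_factorial_atTop M).eventually_lt_const
    (zero_lt_one' ℝ)).exists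
  have hK : ‖volterra A hA hl ^ n‖ ≤ M ^ n / n.factorial := by
    refine ContinuousLinearMap.opNorm_le_bound _ (by positivity) fun u => ?_
    refine (ContinuousMap.norm_le _ (by positivity)).2 fun x => ?_
    refine (norm_volterra_pow_apply_le hA hl n u x).trans ?_
    have h0 : 0 ≤ ∫ t in (x : ℝ)..l, ‖A t‖ := integral_nonneg x.2.2 fun _ _ => norm_nonneg _
    have : ∫ t in (x : ℝ)..l, ‖A t‖ ≤ M := by
      rw [integral_of_le x.2.2]
      exact setIntegral_le_integral hA.norm (Filter.Eventually.of_forall fun t => norm_nonneg _)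
    gcongr
  have h := isUnit_one_sub_of_norm_lt_one (x := volterra A hA hl ^ n) (hK.trans_lt hn)
  -- `1 - K ^ n` is the product of `1 - K` and a geometric sum; the factors commute, so both are
  -- units.
  rw [← mul_neg_geom_sum] at h
  refine (Commute.isUnit_mul_iff ?_).1 h |>.1
  rw [commute_iff_eq, mul_neg_geom_sum, geom_sum_mul_neg]

end Volterra

/-! ### Real solutions of the first order system. -/

namespace DiracKrein

open Set intervalIntegral Filter Topology

/-- `(f, g)` is an absolutely continuous real solution of `-J u' + V u = r u` on `[0, l]`. -/
structure IsRealSol (p q : ℝ → ℝ) (l r : ℝ) (f g : ℝ → ℝ) : Prop where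
  ac_fst : AbsolutelyContinuousOnInterval f 0 l
  ac_snd : AbsolutelyContinuousOnInterval g 0 l
  deriv_fst : ∀ᵐ x, x ∈ Icc 0 l → HasDerivAt f (q x * f x - (r + p x) * g x) x
  deriv_snd : ∀ᵐ x, x ∈ Icc 0 l → HasDerivAt g ((r - p x) * f x - q x * g x) x

lemma IsRealSol.mono {p q : ℝ → ℝ} {l r x : ℝ} {f g : ℝ → ℝ} (h : IsRealSol p q l r f g)
    (hx : x ∈ Icc 0 l) : IsRealSol p q x r f g := by
  have hs : Icc 0 x ⊆ Icc 0 l := Icc_subset_Icc_right hx.2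
  have hs' : uIcc 0 x ⊆ uIcc 0 l := by
    rwa [uIcc_of_le hx.1, uIcc_of_le (hx.1.trans hx.2)]
  refine ⟨h.ac_fst.mono hs', h.ac_snd.mono hs', ?_, ?_⟩
  · filter_upwards [h.deriv_fst] with y hy hy'
    exact hy (hs hy')
  · filter_upwards [h.deriv_snd] with y hy hy'
    exact hy (hs hy')

/-- The Lagrange identity. -/
lemma IsRealSol.lagrange {p q : ℝ → ℝ} {l r s : ℝ} (hl : 0 ≤ l) {f g h k : ℝ → ℝ}
    (hf : IsRealSol p q l r f g) (hh : IsRealSol p q l s h k) :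
    (f l * k l - g l * h l) - (f 0 * k 0 - g 0 * h 0)
      = (s - r) * ∫ x in 0..l, (f x * h x + g x * k x) := by
  have hac := (hf.ac_fst.fun_mul hh.ac_snd).fun_sub (hf.ac_snd.fun_mul hh.ac_fst)
  rw [← hac.integral_deriv_eq_sub, ← intervalIntegral.integral_const_mul]
  refine integral_congr_ae ?_
  filter_upwards [hf.deriv_fst, hf.deriv_snd, hh.deriv_fst, hh.deriv_snd] with x h1 h2 h3 h4 hx
  have hx' : x ∈ Icc 0 l := by
    rw [uIoc_of_le hl] at hx
    exact Ioc_subset_Icc_self hx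
  rw [(((h1 hx').fun_mul (h4 hx')).fun_sub ((h2 hx').fun_mul (h3 hx'))).deriv]
  ring

lemma IsRealSol.wronskian_eq {p q : ℝ → ℝ} {l r x : ℝ} {f g h k : ℝ → ℝ}
    (hf : IsRealSol p q l r f g) (hh : IsRealSol p q l r h k) (hx : x ∈ Icc 0 l) :
    f x * k x - g x * h x = f l * k l - g l * h l := by
  -- With equal spectral parameters the Wronskians at `l` and at `x` both equal the one at `0`.
  have h1 := hf.lagrange (hx.1.trans hx.2) hh
  have h2 := (hf.mono hx).lagrange hx.1 (hh.mono hx)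
  rw [sub_self, zero_mul] at h1 h2
  linarith

/-- The coefficient matrix of the first order system on `[0, l]`, extended by zero. -/
noncomputable def coeff (p q : ℝ → ℝ) (l : ℝ) (t : ℝ) : (ℝ × ℝ) →L[ℝ] (ℝ × ℝ) :=
  (Icc 0 l).indicator q t •
      ((ContinuousLinearMap.fst ℝ ℝ ℝ).prod (-ContinuousLinearMap.snd ℝ ℝ ℝ)) +
    (Icc 0 l).indicator p t •
      ((-ContinuousLinearMap.snd ℝ ℝ ℝ).prod (-ContinuousLinearMap.fst ℝ ℝ ℝ))

/-- The matrix `J` on `[0, l]`, extended by zero. -/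
noncomputable def rotation (l : ℝ) (t : ℝ) : (ℝ × ℝ) →L[ℝ] (ℝ × ℝ) :=
  (Icc 0 l).indicator (fun _ => (1 : ℝ)) t •
    ((-ContinuousLinearMap.snd ℝ ℝ ℝ).prod (ContinuousLinearMap.fst ℝ ℝ ℝ))

lemma integrable_coeff {p q : ℝ → ℝ} {l : ℝ} (hp : IntegrableOn p (Icc 0 l))
    (hq : IntegrableOn q (Icc 0 l)) : Integrable (coeff p q l) := by
  have h1 := (hq.integrable_indicator measurableSet_Icc).smul_const
    ((ContinuousLinearMap.fst ℝ ℝ ℝ).prod (-ContinuousLinearMap.snd ℝ ℝ ℝ))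
  have h2 := (hp.integrable_indicator measurableSet_Icc).smul_const
    ((-ContinuousLinearMap.snd ℝ ℝ ℝ).prod (-ContinuousLinearMap.fst ℝ ℝ ℝ))
  exact h1.add h2

lemma integrable_rotation (l : ℝ) : Integrable (rotation l) :=
  ((integrableOn_const (by simp) (by simp)).integrable_indicator measurableSet_Icc).smul_const _

lemma coeff_add_rotation_apply {p q : ℝ → ℝ} {l r t : ℝ} (ht : t ∈ Icc 0 l) (v : ℝ × ℝ) :
    (coeff p q l t + r • rotation l t) v
      = (q t * v.1 - (r + p t) * v.2, (r - p t) * v.1 - q t * v.2) := by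
  ext <;> simp [coeff, rotation, ht] <;> ring

/-- The integral equation is based at `l`, so `c` is the outer value. Primitives of integrable
functions are absolutely continuous and differentiable almost everywhere, which is all that `L¹`
potentials allow. -/
lemma isRealSol_of_integral {p q : ℝ → ℝ} {l r : ℝ} (hl : 0 ≤ l) {A : ℝ → (ℝ × ℝ) →L[ℝ] (ℝ × ℝ)}
    (hA : Integrable A) (hAv : ∀ t ∈ Icc 0 l, ∀ v : ℝ × ℝ,
      A t v = (q t * v.1 - (r + p t) * v.2, (r - p t) * v.1 - q t * v.2))
    {c : ℝ × ℝ} {u : C(Icc 0 l, ℝ × ℝ)} (hu : ∀ x, u x = c + volterra A hA hl u x) :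
    ∃ f g, IsRealSol p q l r f g ∧ ∀ x : Icc 0 l, (f x, g x) = u x := by
  have hi := integrable_apply_projIcc hA hl u
  have hi1 : Integrable fun t => (A t (u (projIcc 0 l hl t))).1 := hi.fst
  have hi2 : Integrable fun t => (A t (u (projIcc 0 l hl t))).2 := hi.snd
  have hval : ∀ x (hx : x ∈ Icc 0 l),
      (c.1 + ∫ t in l..x, (A t (u (projIcc 0 l hl t))).1,
        c.2 + ∫ t in l..x, (A t (u (projIcc 0 l hl t))).2) = u ⟨x, hx⟩ := by
    intro x hx
    have h1 := (ContinuousLinearMap.fst ℝ ℝ ℝ).intervalIntegral_comp_comm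
      (hi.intervalIntegrable (a := l) (b := x))
    have h2 := (ContinuousLinearMap.snd ℝ ℝ ℝ).intervalIntegral_comp_comm
      (hi.intervalIntegrable (a := l) (b := x))
    simp only [ContinuousLinearMap.coe_fst', ContinuousLinearMap.coe_snd'] at h1 h2
    rw [hu ⟨x, hx⟩, h1, h2, volterra_apply]
    rfl
  refine ⟨fun x => c.1 + ∫ t in l..x, (A t (u (projIcc 0 l hl t))).1,
    fun x => c.2 + ∫ t in l..x, (A t (u (projIcc 0 l hl t))).2,
    ⟨?_, ?_, ?_, ?_⟩, fun x => hval x x.2⟩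
  · exact (hi1.intervalIntegrable.absolutelyContinuousOnInterval_intervalIntegral
      right_mem_uIcc).const_add c.1
  · exact (hi2.intervalIntegrable.absolutelyContinuousOnInterval_intervalIntegral
      right_mem_uIcc).const_add c.2
  · filter_upwards [(hi1.intervalIntegrable (a := 0) (b := l)).ae_hasDerivAt_integral] with x h hx
    have hx' : x ∈ uIcc 0 l := by rwa [uIcc_of_le hl]
    have := (h hx' l right_mem_uIcc).const_add c.1
    rw [projIcc_of_mem hl hx, hAv x hx, ← hval x hx] at this
    exact this
  · filter_upwards [(hi2.intervalIntegrable (a := 0) (b := l)).ae_hasDerivAt_integral] with x h hx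
    have hx' : x ∈ uIcc 0 l := by rwa [uIcc_of_le hl]
    have := (h hx' l right_mem_uIcc).const_add c.2
    rw [projIcc_of_mem hl hx, hAv x hx, ← hval x hx] at this
    exact this

/-- Existence of solutions with prescribed values at `l`, continuous in the spectral parameter. -/
theorem exists_isRealSol {p q : ℝ → ℝ} {l : ℝ} (hl : 0 ≤ l) (hp : IntegrableOn p (Icc 0 l))
    (hq : IntegrableOn q (Icc 0 l)) (c : ℝ × ℝ) :
    ∃ F G : ℝ → ℝ → ℝ, (∀ r, IsRealSol p q l r (F r) (G r)) ∧
      (∀ r, F r l = c.1) ∧ (∀ r, G r l = c.2) ∧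
      (Continuous fun z : ℝ × ℝ => F z.1 (projIcc 0 l hl z.2)) ∧
      Continuous fun z : ℝ × ℝ => G z.1 (projIcc 0 l hl z.2) := by
  set K : ℝ → C(Icc 0 l, ℝ × ℝ) →L[ℝ] C(Icc 0 l, ℝ × ℝ) := fun r =>
    volterra _ (integrable_coeff hp hq) hl + r • volterra _ (integrable_rotation l) hl
  have hK : ∀ r, K r = volterra _ ((integrable_coeff hp hq).add
      ((integrable_rotation l).smul r)) hl := fun r => (volterra_add_smul _ _ _ _).symm
  have hunit : ∀ r, IsUnit (1 - K r) := fun r => by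
    rw [hK]
    exact isUnit_one_sub_volterra _ _
  -- The solution of `u = c + K r u`. Inversion is continuous at units, so `u` is continuous in `r`
  -- for the uniform norm; joint continuity in `(r, x)` follows.
  set u : ℝ → C(Icc 0 l, ℝ × ℝ) := fun r =>
    Ring.inverse (1 - K r) (ContinuousMap.const _ c)
  have hucont : Continuous u := by
    have h1 : Continuous fun r => Ring.inverse (1 - K r) := by
      refine continuous_iff_continuousAt.2 fun r => ?_
      have h2 := NormedRing.inverse_continuousAt
        (R := C(Icc 0 l, ℝ × ℝ) →L[ℝ] C(Icc 0 l, ℝ × ℝ)) (hunit r).unit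
      refine ContinuousAt.comp (f := fun r => 1 - K r) h2 ?_
      exact (continuous_const.sub (continuous_const.add
        (continuous_id.smul continuous_const))).continuousAt
    exact h1.clm_apply continuous_const
  have hu : ∀ r x, u r x = c + volterra _ ((integrable_coeff hp hq).add
      ((integrable_rotation l).smul r)) hl (u r) x := by
    intro r x
    have h1 : (1 - K r) (u r) = ContinuousMap.const _ c := by
      change ((1 - K r) * Ring.inverse (1 - K r)) (ContinuousMap.const _ c) = _
      rw [Ring.mul_inverse_cancel _ (hunit r)]
      rfl
    have h2 := congrArg (fun w : C(Icc 0 l, ℝ × ℝ) => w x) h1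
    rw [← hK]
    exact sub_eq_iff_eq_add.1 h2
  have hsol := fun r => isRealSol_of_integral (p := p) (q := q) (r := r) hl _
    (fun t ht v => coeff_add_rotation_apply ht v) (hu r)
  choose F G hFG hval using hsol
  have hl' : ∀ r, (F r l, G r l) = c := fun r => by
    rw [hval r ⟨l, hl, le_rfl⟩, hu, volterra_apply]
    simp
  have hjoint : Continuous fun z : ℝ × ℝ => u z.1 (projIcc 0 l hl z.2) :=
    (hucont.comp continuous_fst).eval (continuous_projIcc.comp continuous_snd)
  refine ⟨F, G, hFG, fun r => congrArg Prod.fst (hl' r), fun r => congrArg Prod.snd (hl' r),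
    ?_, ?_⟩
  · exact hjoint.fst.congr fun z => (congrArg Prod.fst (hval z.1 (projIcc 0 l hl z.2))).symm
  · exact hjoint.snd.congr fun z => (congrArg Prod.snd (hval z.1 (projIcc 0 l hl z.2))).symm

/-- A family of real solutions satisfying the outer boundary condition with parameter `α`,
continuous in the spectral parameter. -/
structure OuterFamily (p q : ℝ → ℝ) (l α : ℝ) (F G : ℝ → ℝ → ℝ) : Prop where
  sol : ∀ r, IsRealSol p q l r (F r) (G r)
  fst_outer : ∀ r, F r l = Real.sin α
  snd_outer : ∀ r, G r l = -Real.cos α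
  continuous_fst : ∀ hl : 0 ≤ l, Continuous fun z : ℝ × ℝ => F z.1 (projIcc 0 l hl z.2)
  continuous_snd : ∀ hl : 0 ≤ l, Continuous fun z : ℝ × ℝ => G z.1 (projIcc 0 l hl z.2)

lemma exists_outerFamily {p q : ℝ → ℝ} {l : ℝ} (hl : 0 ≤ l) (hp : IntegrableOn p (Icc 0 l))
    (hq : IntegrableOn q (Icc 0 l)) (α : ℝ) : ∃ F G, OuterFamily p q l α F G := by
  obtain ⟨F, G, h, h1, h2, h3, h4⟩ := exists_isRealSol hl hp hq (Real.sin α, -Real.cos α)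
  exact ⟨F, G, h, h1, h2, fun _ => h3, fun _ => h4⟩

/-! ### Outer families and the poles of the Weyl functions. -/

namespace OuterFamily

variable {p q : ℝ → ℝ} {l α : ℝ} {F G : ℝ → ℝ → ℝ}

lemma continuous_fst_zero (h : OuterFamily p q l α F G) (hl : 0 ≤ l) :
    Continuous fun r => F r 0 := by
  have := (h.continuous_fst hl).comp (continuous_id.prodMk (continuous_const (y := (0 : ℝ))))
  simpa [Function.comp_def, projIcc_left] using this

lemma continuous_snd_zero (h : OuterFamily p q l α F G) (hl : 0 ≤ l) :
    Continuous fun r => G r 0 := by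
  have := (h.continuous_snd hl).comp (continuous_id.prodMk (continuous_const (y := (0 : ℝ))))
  simpa [Function.comp_def, projIcc_left] using this

/-- A real solution is determined by its values at `l`. -/
lemma eq_mul_of_isRealSol (h : OuterFamily p q l α F G) (hl : 0 ≤ l)
    (hp : IntegrableOn p (Icc 0 l)) (hq : IntegrableOn q (Icc 0 l)) {r : ℝ} {f g : ℝ → ℝ}
    (hf : IsRealSol p q l r f g) (hbc : Real.cos α * f l + Real.sin α * g l = 0) {x : ℝ}
    (hx : x ∈ Icc 0 l) :
    f x = (f l * Real.sin α - g l * Real.cos α) * F r x ∧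
      g x = (f l * Real.sin α - g l * Real.cos α) * G r x := by
  -- A second solution chosen so that its Wronskian with the outer family is `sin² α + cos² α = 1`.
  -- The outer condition makes the Wronskian of `(f, g)` with the family vanish, and the coefficient
  -- sought is its Wronskian with the second solution.
  obtain ⟨F₂, G₂, h₂, h₂F, h₂G, -, -⟩ := exists_isRealSol hl hp hq (Real.cos α, Real.sin α)
  have e1 := (h.sol r).wronskian_eq (h₂ r) hx
  have e2 := hf.wronskian_eq (h₂ r) hx
  have e3 := hf.wronskian_eq (h.sol r) hx
  rw [h.fst_outer, h.snd_outer, h₂F, h₂G] at e1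
  rw [h₂F, h₂G] at e2
  rw [h.fst_outer, h.snd_outer] at e3
  have e0 := Real.sin_sq_add_cos_sq α
  have e1' : F r x * G₂ r x - G r x * F₂ r x = 1 := by rw [e1]; linarith
  have e3' : f x * G r x - g x * F r x = 0 := by rw [e3]; linarith
  simp only at e2
  rw [← e2]
  constructor
  · linear_combination (-f x) * e1' - F₂ r x * e3'
  · linear_combination (-g x) * e1' - G₂ r x * e3'

lemma ne_zero (h : OuterFamily p q l α F G) (hl : 0 ≤ l)
    (hp : IntegrableOn p (Icc 0 l)) (hq : IntegrableOn q (Icc 0 l)) {r : ℝ} (h0 : F r 0 = 0) :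
    G r 0 ≠ 0 := by
  intro h1
  obtain ⟨F₂, G₂, h₂, h₂F, h₂G, -, -⟩ := exists_isRealSol hl hp hq (Real.cos α, Real.sin α)
  have e1 := (h.sol r).wronskian_eq (h₂ r) ⟨le_rfl, hl⟩
  rw [h.fst_outer, h.snd_outer, h₂F, h₂G, h0, h1] at e1
  have e0 := Real.sin_sq_add_cos_sq α
  simp only at e1
  linarith

/-- Near a zero `r` of `F · 0`, the function `F · 0` is a positive multiple of
`(s - r) / G r 0`. -/
lemma exists_continuous_pos (h : OuterFamily p q l α F G) (hl : 0 < l) (r : ℝ) :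
    ∃ I : ℝ → ℝ, Continuous I ∧ 0 < I r ∧
      (F r 0 = 0 → ∀ s, G r 0 * F s 0 = (s - r) * I s) := by
  have hF := h.continuous_fst hl.le
  have hG := h.continuous_snd hl.le
  have hval : ∀ x ∈ uIcc 0 l, ((projIcc 0 l hl.le x : Icc 0 l) : ℝ) = x := by
    intro x hx
    rw [uIcc_of_le hl.le] at hx
    rw [projIcc_of_mem hl.le hx]
  -- The integral from the Lagrange identity for parameters `r` and `s`; `projIcc` allows the joint
  -- continuity of the family to be used on the whole line.
  refine ⟨fun s => ∫ x in 0..l, (F r (projIcc 0 l hl.le x) * F s (projIcc 0 l hl.le x) +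
    G r (projIcc 0 l hl.le x) * G s (projIcc 0 l hl.le x)), ?_, ?_, ?_⟩
  · refine intervalIntegral.continuous_parametric_intervalIntegral_of_continuous' ?_ 0 l
    have e1 := hF.comp ((continuous_const (y := r)).prodMk _root_.continuous_snd)
      (X := ℝ × ℝ)
    have e2 := hG.comp ((continuous_const (y := r)).prodMk _root_.continuous_snd)
      (X := ℝ × ℝ)
    exact (e1.mul hF).add (e2.mul hG)
  · have e1 := hF.comp ((continuous_const (y := r)).prodMk continuous_id)
    have e2 := hG.comp ((continuous_const (y := r)).prodMk continuous_id)
    refine intervalIntegral.integral_pos hl ((e1.mul e1).add (e2.mul e2)).continuousOn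
      (fun x _ => add_nonneg (mul_self_nonneg _) (mul_self_nonneg _)) ⟨l, ⟨hl.le, le_rfl⟩, ?_⟩
    rw [hval l right_mem_uIcc, h.fst_outer, h.snd_outer]
    nlinarith [Real.sin_sq_add_cos_sq α]
  · intro h0 s
    -- Both solutions have the same values at `l`, so the boundary term there cancels; at `0` only
    -- `G r 0 * F s 0` survives.
    have e := (h.sol r).lagrange hl.le (h.sol s)
    rw [h.fst_outer, h.snd_outer, h.fst_outer, h.snd_outer, h0] at e
    have e' : ∫ x in 0..l, (F r (projIcc 0 l hl.le x) * F s (projIcc 0 l hl.le x) +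
        G r (projIcc 0 l hl.le x) * G s (projIcc 0 l hl.le x))
        = ∫ x in 0..l, (F r x * F s x + G r x * G s x) := by
      refine integral_congr fun x hx => ?_
      simp only [hval x hx]
    simp only [e']
    linarith

/-- At its poles, the Weyl function `G · 0 / F · 0` tends to `+∞` from the right and to `-∞` from
the left. -/
lemma tendsto_div_of_fst_eq_zero (h : OuterFamily p q l α F G) (hl : 0 < l)
    (hp : IntegrableOn p (Icc 0 l)) (hq : IntegrableOn q (Icc 0 l)) {r : ℝ} (h0 : F r 0 = 0) :
    Tendsto (fun s => G s 0 / F s 0) (𝓝[>] r) atTop ∧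
      Tendsto (fun s => G s 0 / F s 0) (𝓝[<] r) atBot := by
  obtain ⟨I, hI, hpos, heq⟩ := h.exists_continuous_pos hl r
  have hG := h.ne_zero hl.le hp hq h0
  -- This isolates the factor `1 / (s - r)`; the remaining factor tends to `(G r 0)² / I r > 0`.
  have hd : ∀ s, G s 0 / F s 0 = (s - r)⁻¹ * (G s 0 * G r 0 / I s) := by
    intro s
    have e : F s 0 = (s - r) * I s / G r 0 := by
      rw [← heq h0 s]
      field_simp
    rw [e, div_div_eq_mul_div, mul_comm (s - r), div_mul_eq_div_div, div_eq_inv_mul _ (s - r)]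
  have hlim : Tendsto (fun s => G s 0 * G r 0 / I s) (𝓝 r) (𝓝 (G r 0 * G r 0 / I r)) :=
    ((h.continuous_snd_zero hl.le).tendsto r |>.mul_const _).div (hI.tendsto r) hpos.ne'
  have hlp : 0 < G r 0 * G r 0 / I r := div_pos (mul_self_pos.2 hG) hpos
  simp only [hd]
  have hsub : Tendsto (fun s => s - r) (𝓝 r) (𝓝 0) := by
    simpa using (continuous_sub_right r).tendsto r
  constructor
  · refine Tendsto.atTop_mul_pos hlp (tendsto_inv_nhdsGT_zero.comp ?_)
      (hlim.mono_left nhdsWithin_le_nhds)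
    refine tendsto_nhdsWithin_iff.2 ⟨hsub.mono_left nhdsWithin_le_nhds, ?_⟩
    filter_upwards [self_mem_nhdsWithin] with s hs
    exact sub_pos.2 (mem_Ioi.1 hs)
  · refine Tendsto.atBot_mul_pos hlp (tendsto_inv_nhdsLT_zero.comp ?_)
      (hlim.mono_left nhdsWithin_le_nhds)
    refine tendsto_nhdsWithin_iff.2 ⟨hsub.mono_left nhdsWithin_le_nhds, ?_⟩
    filter_upwards [self_mem_nhdsWithin] with s hs
    exact sub_neg.2 (mem_Iio.1 hs)

/-- Zeros of `F · 0` are isolated from the right. -/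
lemma eventually_ne_zero (h : OuterFamily p q l α F G) (hl : 0 < l) (r : ℝ) :
    ∀ᶠ s in 𝓝[>] r, F s 0 ≠ 0 := by
  by_cases h0 : F r 0 = 0
  · obtain ⟨I, hI, hpos, heq⟩ := h.exists_continuous_pos hl r
    filter_upwards [self_mem_nhdsWithin,
      nhdsWithin_le_nhds ((hI.tendsto r).eventually_const_lt hpos)] with s hs hIs hz
    have e := heq h0 s
    rw [hz, mul_zero] at e
    exact (mul_pos (sub_pos.2 hs) hIs).ne e
  · exact nhdsWithin_le_nhds
      (((h.continuous_fst_zero hl.le).tendsto r).eventually_ne h0)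

end OuterFamily

end DiracKrein

/-! ### Sums of quotients with poles of one sign. -/

open Set Filter Topology in
/-- A finite sum of functions each of which diverges to `+∞` or converges, at least one of them
diverging, diverges to `+∞`. -/
lemma tendsto_sum_atTop_of_or {ι α : Type*} [Fintype ι] {l : Filter α} {f : ι → α → ℝ}
    (h : ∀ i, Tendsto (f i) l atTop ∨ ∃ c, Tendsto (f i) l (𝓝 c))
    {i₀ : ι} (h₀ : Tendsto (f i₀) l atTop) : Tendsto (fun x => ∑ i, f i x) l atTop := by
  classical
  have hb : ∀ i, ∃ C, ∀ᶠ x in l, C ≤ f i x := fun i => by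
    rcases h i with hi | ⟨c, hi⟩
    · exact ⟨0, hi.eventually_ge_atTop 0⟩
    · exact ⟨c - 1, (hi.eventually_const_lt (sub_one_lt c)).mono fun _ hx => hx.le⟩
  choose C hC using hb
  simp_rw [fun x => (Finset.add_sum_erase Finset.univ (fun i => f i x) (Finset.mem_univ i₀)).symm]
  refine tendsto_atTop_add_right_of_le' l (∑ i ∈ Finset.univ.erase i₀, C i) h₀ ?_
  filter_upwards [eventually_all.2 hC] with x hx
  exact Finset.sum_le_sum fun i _ => hx i

namespace DiracKrein

open Set Filter Topology

section IntermediateValue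

variable {ι : Type*} [Fintype ι] {φ ψ : ι → ℝ → ℝ}

/-- Between two poles of a finite sum of quotients whose poles all have the sign behaviour of
`1 / (s - r)`, every real value is attained at a point which is not a pole. -/
lemma exists_sum_div_eq (hφ : ∀ i, Continuous (φ i)) (hψ : ∀ i, Continuous (ψ i))
    (hne : ∀ i r, ∀ᶠ s in 𝓝[>] r, φ i s ≠ 0)
    (hpole : ∀ i r, φ i r = 0 → Tendsto (fun s => ψ i s / φ i s) (𝓝[>] r) atTop ∧
      Tendsto (fun s => ψ i s / φ i s) (𝓝[<] r) atBot)
    {a b : ℝ} (hab : a < b) (ha : ∃ i, φ i a = 0) (hb : ∃ i, φ i b = 0) (t : ℝ) :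
    ∃ c ∈ Ioo a b, (∀ i, φ i c ≠ 0) ∧ ∑ i, ψ i c / φ i c = t := by
  obtain ⟨e, hae, he⟩ : ∃ e ∈ Ioi a, Ioo a e ⊆ {s | ∀ i, φ i s ≠ 0} :=
    mem_nhdsGT_iff_exists_Ioo_subset.1 (eventually_all.2 fun i => hne i a)
  have hae' : a < e := hae
  have heb : e ≤ b := by
    by_contra! hlt
    obtain ⟨i, hi⟩ := hb
    exact he ⟨hab, hlt⟩ i hi
  -- The least element `d` of this set is the first pole after `a`: there are none in `(a, e)`, so
  -- starting at `e` loses nothing and makes the set compact. It contains `b`.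
  set S := Icc e b ∩ ⋃ i, φ i ⁻¹' {0}
  have hSc : IsCompact S :=
    isCompact_Icc.inter_right (isClosed_iUnion_of_finite fun i => isClosed_singleton.preimage (hφ i))
  obtain ⟨d, ⟨⟨hed, hdb⟩, hd⟩, hmin⟩ := hSc.exists_isLeast
    ⟨b, ⟨heb, le_rfl⟩, by simpa using hb⟩
  have hd' : ∃ i, φ i d = 0 := by simpa using hd
  have had : a < d := hae'.trans_le hed
  have hnz : ∀ s ∈ Ioo a d, ∀ i, φ i s ≠ 0 := by
    intro s hs i hi
    rcases lt_or_ge s e with h | h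
    · exact he ⟨hs.1, h⟩ i hi
    · exact hs.2.not_ge (hmin ⟨⟨h, hs.2.le.trans hdb⟩, mem_iUnion.2 ⟨i, hi⟩⟩)
  have hlim : ∀ r i, φ i r ≠ 0 → Tendsto (fun s => ψ i s / φ i s) (𝓝 r) (𝓝 (ψ i r / φ i r)) :=
    fun r i h => ((hψ i).tendsto r).div ((hφ i).tendsto r) h
  have htop : Tendsto (fun s => ∑ i, ψ i s / φ i s) (𝓝[>] a) atTop := by
    obtain ⟨i₀, h₀⟩ := ha
    refine tendsto_sum_atTop_of_or (fun i => ?_) (hpole i₀ a h₀).1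
    by_cases h : φ i a = 0
    · exact Or.inl (hpole i a h).1
    · exact Or.inr ⟨_, (hlim a i h).mono_left nhdsWithin_le_nhds⟩
  have hbot : Tendsto (fun s => ∑ i, ψ i s / φ i s) (𝓝[<] d) atBot := by
    obtain ⟨i₀, h₀⟩ := hd'
    rw [← tendsto_neg_atTop_iff]
    simp_rw [← Finset.sum_neg_distrib]
    refine tendsto_sum_atTop_of_or (fun i => ?_) (tendsto_neg_atTop_iff.2 (hpole i₀ d h₀).2)
    by_cases h : φ i d = 0
    · exact Or.inl (tendsto_neg_atTop_iff.2 (hpole i d h).2)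
    · exact Or.inr ⟨_, ((hlim d i h).mono_left nhdsWithin_le_nhds).neg⟩
  have hcont : ContinuousOn (fun s => ∑ i, ψ i s / φ i s) (Ioo a d) :=
    continuousOn_finsetSum _ fun i _ =>
      (hψ i).continuousOn.div (hφ i).continuousOn fun s hs => hnz s hs i
  obtain ⟨c, hc, hct⟩ := isPreconnected_Ioo.intermediate_value_Iii
    (le_principal_iff.2 (Ioo_mem_nhdsLT had)) (le_principal_iff.2 (Ioo_mem_nhdsGT had))
    hcont hbot htop (mem_univ t)
  exact ⟨c, ⟨hc.1, hc.2.trans_le hdb⟩, hnz c hc, hct⟩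

end IntermediateValue

/-! ### Passage between complex and real solutions. -/

lemma H_apply_zero (p q : ℝ → ℝ) (u : ℝ → C2) (x : ℝ) :
    H p q u x 0 = deriv u x 1 + (p x * u x 0 + q x * u x 1) := by
  simp [H, J, V, Matrix.toEuclideanLin, Matrix.mulVec, dotProduct, Fin.sum_univ_two]

lemma H_apply_one (p q : ℝ → ℝ) (u : ℝ → C2) (x : ℝ) :
    H p q u x 1 = -deriv u x 0 + (q x * u x 0 - p x * u x 1) := by
  simp [H, J, V, Matrix.toEuclideanLin, Matrix.mulVec, dotProduct, Fin.sum_univ_two,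
    sub_eq_add_neg]

/-- The composition of a coordinate of `ℂ²` with a real linear functional on `ℂ`. -/
noncomputable def coordFunctional (L : ℂ →L[ℝ] ℝ) (i : Fin 2) : C2 →L[ℝ] ℝ :=
  L.comp ((EuclideanSpace.proj i : C2 →L[ℂ] ℂ).restrictScalars ℝ)

/-- Real parts and imaginary parts of complex solutions are real solutions. -/
lemma isRealSol_comp {p q : ℝ → ℝ} {l r : ℝ} (hl : 0 < l) {u : ℝ → C2}
    (hu : AbsolutelyContinuousOnInterval u 0 l)
    (hH : H p q u =ᵐ[edgeMeasure l] fun x => (r : ℂ) • u x) (L : ℂ →L[ℝ] ℝ) :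
    IsRealSol p q l r (fun x => L (u x 0)) (fun x => L (u x 1)) := by
  have hd := hu.boundedVariationOn.ae_differentiableAt_of_mem_uIcc
  rw [uIcc_of_le hl.le] at hd
  rw [Filter.EventuallyEq, ae_restrict_iff' measurableSet_Icc] at hH
  have hLr : ∀ (c : ℝ) (z : ℂ), L ((c : ℂ) * z) = c * L z := fun c z => by
    rw [← Complex.real_smul, map_smul, smul_eq_mul]
  have hac := fun i => AbsolutelyContinuousOnInterval.lipschitz_comp
    (coordFunctional L i).lipschitz hu
  have hder : ∀ i x, DifferentiableAt ℝ u x →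
      HasDerivAt (fun x => L (u x i)) (L (deriv u x i)) x := fun i x hx =>
    (coordFunctional L i).hasFDerivAt.comp_hasDerivAt x hx.hasDerivAt
  refine ⟨hac 0, hac 1, ?_, ?_⟩
  · filter_upwards [hd, hH] with x h1 h2 hx
    have h3 := hder 0 x (h1 hx)
    have h4 := congrArg (fun v : C2 => v 1) (h2 hx)
    simp only [H_apply_one, PiLp.smul_apply, smul_eq_mul] at h4
    have h5 : deriv u x 0 = q x * u x 0 - (r * u x 1 + p x * u x 1) := by
      linear_combination -h4
    rw [h5, map_sub, map_add, hLr, hLr, hLr] at h3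
    rwa [add_mul]
  · filter_upwards [hd, hH] with x h1 h2 hx
    have h3 := hder 1 x (h1 hx)
    have h4 := congrArg (fun v : C2 => v 0) (h2 hx)
    simp only [H_apply_zero, PiLp.smul_apply, smul_eq_mul] at h4
    have h5 : deriv u x 1 = r * u x 0 - p x * u x 0 - q x * u x 1 := by
      linear_combination h4
    rw [h5, map_sub, map_sub, hLr, hLr, hLr] at h3
    rwa [sub_mul]

/-- The `ℂ²`-valued function with real components `f` and `g`. -/
noncomputable def realVec (f g : ℝ → ℝ) (x : ℝ) : C2 := !₂[(f x : ℂ), (g x : ℂ)]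

@[simp] lemma realVec_zero (f g : ℝ → ℝ) (x : ℝ) : realVec f g x 0 = f x := rfl

@[simp] lemma realVec_one (f g : ℝ → ℝ) (x : ℝ) : realVec f g x 1 = g x := rfl

/-- The inclusion of `ℝ²` into `ℂ²`. -/
noncomputable def ofRealPair : ℝ × ℝ →L[ℝ] C2 :=
  (PiLp.continuousLinearEquiv 2 ℝ fun _ : Fin 2 => ℂ).symm.toContinuousLinearMap.comp
    (ContinuousLinearMap.pi ![Complex.ofRealCLM.comp (ContinuousLinearMap.fst ℝ ℝ ℝ),
      Complex.ofRealCLM.comp (ContinuousLinearMap.snd ℝ ℝ ℝ)])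

lemma ofRealPair_apply (v : ℝ × ℝ) : ofRealPair v = !₂[(v.1 : ℂ), (v.2 : ℂ)] := by
  ext i
  fin_cases i <;> simp [ofRealPair]

lemma ac_prodMk {f g : ℝ → ℝ} {a b : ℝ}
    (hf : AbsolutelyContinuousOnInterval f a b) (hg : AbsolutelyContinuousOnInterval g a b) :
    AbsolutelyContinuousOnInterval (fun x => (f x, g x)) a b := by
  refine squeeze_zero (fun E => Finset.sum_nonneg fun i _ => dist_nonneg) (fun E => ?_)
    (by simpa using Tendsto.add hf hg)
  rw [← Finset.sum_add_distrib]
  refine Finset.sum_le_sum fun i _ => ?_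
  rw [Prod.dist_eq]
  exact max_le_add_of_nonneg dist_nonneg dist_nonneg

namespace IsRealSol

variable {p q : ℝ → ℝ} {l r : ℝ} {f g : ℝ → ℝ}

lemma ac_realVec (h : IsRealSol p q l r f g) :
    AbsolutelyContinuousOnInterval (realVec f g) 0 l := by
  have h1 := AbsolutelyContinuousOnInterval.lipschitz_comp ofRealPair.lipschitz
    (ac_prodMk h.ac_fst h.ac_snd)
  simp only [ofRealPair_apply] at h1
  exact h1

lemma H_realVec (h : IsRealSol p q l r f g) :
    H p q (realVec f g) =ᵐ[edgeMeasure l] (r : ℂ) • realVec f g := by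
  rw [Filter.EventuallyEq, ae_restrict_iff' measurableSet_Icc]
  filter_upwards [h.deriv_fst, h.deriv_snd] with x h1 h2 hx
  have h3 := ofRealPair.hasFDerivAt.comp_hasDerivAt x ((h1 hx).prodMk (h2 hx))
  have h4 : deriv (realVec f g) x = ofRealPair
      (q x * f x - (r + p x) * g x, (r - p x) * f x - q x * g x) := by
    rw [← h3.deriv]
    congr 1
    funext y
    exact (ofRealPair_apply (f y, g y)).symm
  rw [ofRealPair_apply] at h4
  ext i
  fin_cases i
  · change H p q (realVec f g) x 0 = (r : ℂ) * (f x : ℂ)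
    rw [H_apply_zero, h4]
    simp
    ring
  · change H p q (realVec f g) x 1 = (r : ℂ) * (g x : ℂ)
    rw [H_apply_one, h4]
    simp
    ring

end IsRealSol

lemma memLp_of_ac {l : ℝ} (hl : 0 < l) {u : ℝ → C2} (hu : AbsolutelyContinuousOnInterval u 0 l) :
    MemLp u 2 (edgeMeasure l) := by
  obtain ⟨C, hC⟩ := hu.exists_bound
  have hc := hu.continuousOn
  rw [uIcc_of_le hl.le] at hC hc
  refine MemLp.of_bound (hc.aestronglyMeasurable measurableSet_Icc) C ?_
  exact (ae_restrict_iff' measurableSet_Icc).2 (Eventually.of_forall hC)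

/-- A complex solution which satisfies the outer boundary condition is a multiple of the member of
the outer family. -/
lemma OuterFamily.exists_eq_smul {p q : ℝ → ℝ} {l α : ℝ} {F G : ℝ → ℝ → ℝ}
    (h : OuterFamily p q l α F G) (hl : 0 < l)
    (hp : IntegrableOn p (Icc 0 l)) (hq : IntegrableOn q (Icc 0 l)) {r : ℝ} {u : ℝ → C2}
    (hu : AbsolutelyContinuousOnInterval u 0 l)
    (hH : H p q u =ᵐ[edgeMeasure l] fun x => (r : ℂ) • u x)
    (hbc : (Real.cos α : ℂ) * u l 0 + (Real.sin α : ℂ) * u l 1 = 0) :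
    ∃ c : ℂ, ∀ x ∈ Icc 0 l, u x = c • realVec (F r) (G r) x := by
  -- The coefficients of the system are real, so any real functional of a solution is a real
  -- solution. The real and imaginary parts suffice to recover the complex identity.
  have key : ∀ L : ℂ →L[ℝ] ℝ, ∀ x ∈ Icc 0 l,
      L (u x 0) = L (u l 0 * Real.sin α - u l 1 * Real.cos α) * F r x ∧
      L (u x 1) = L (u l 0 * Real.sin α - u l 1 * Real.cos α) * G r x := by
    intro L x hx
    have hLr : ∀ (c : ℝ) (z : ℂ), L ((c : ℂ) * z) = c * L z := fun c z => by
      rw [← Complex.real_smul, map_smul, smul_eq_mul]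
    have hb := congrArg L hbc
    rw [map_add, hLr, hLr, map_zero] at hb
    have := h.eq_mul_of_isRealSol hl.le hp hq (isRealSol_comp hl hu hH L) hb hx
    rw [map_sub, mul_comm (u l 0), mul_comm (u l 1), hLr, hLr, mul_comm (Real.sin α),
      mul_comm (Real.cos α)]
    exact this
  refine ⟨u l 0 * Real.sin α - u l 1 * Real.cos α, fun x hx => ?_⟩
  have hre := key Complex.reCLM x hx
  have him := key Complex.imCLM x hx
  ext i
  fin_cases i
  · change u x 0 = _ * (F r x : ℂ)
    refine Complex.ext ?_ ?_
    · rw [Complex.re_mul_ofReal]; exact hre.1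
    · rw [Complex.im_mul_ofReal]; exact him.1
  · change u x 1 = _ * (G r x : ℂ)
    refine Complex.ext ?_ ?_
    · rw [Complex.re_mul_ofReal]; exact hre.2
    · rw [Complex.im_mul_ofReal]; exact him.2

end DiracKrein

/-! ### Eigenvalues of the star graph operator in terms of the outer families. -/

namespace DiracKreinStar

open DiracKrein

variable {n : ℕ} {G : DiracKreinStar n} {φ ψ : Fin n → ℝ → ℝ → ℝ}

lemma memMaxDomain_realVec {j : Fin n} {F K : ℝ → ℝ → ℝ}
    (h : OuterFamily (G.p j) (G.q j) (G.len j) (G.α j) F K) (r : ℝ) :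
    G.MemMaxDomain j (realVec (F r) (K r)) where
  ac := (h.sol r).ac_realVec
  memLp := (memLp_congr_ae (h.sol r).H_realVec).2
    ((memLp_of_ac (G.len_pos j) (h.sol r).ac_realVec).const_smul _)
  outer := by
    rw [realVec_zero, realVec_one, h.fst_outer, h.snd_outer]
    push_cast
    ring

/-- If no member of the outer families vanishes in its first component at the centre, then the
eigenspace is at most one dimensional. -/
lemma exists_fst_eq_zero_of_isMultipleEigenvalue
    (h : ∀ j, OuterFamily (G.p j) (G.q j) (G.len j) (G.α j) (φ j) (ψ j)) {τ : EReal} {r : ℝ}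
    (hr : (G.T τ).IsMultipleEigenvalue r) : ∃ j, φ j r 0 = 0 := by
  by_contra! hne
  have hLp := fun j => (memLp_of_ac (G.len_pos j) ((h j).sol r).ac_realVec).const_smul
    (((φ j r 0)⁻¹ : ℝ) : ℂ)
  have hle : Module.rank ℂ ((G.T τ).pointEigenspace r) ≤ 1 := by
    -- The spanning vector is the family normalised to have first component `1` at the centre on
    -- every edge; the coefficient of an eigenfunction is then its common central value `s`.
    refine (rank_submodule_le_one_iff' _).2 ⟨WithLp.toLp 2 fun j => (hLp j).toLp _, ?_⟩
    intro f hf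
    rw [LinearPMap.mem_pointEigenspace_iff, T_graph] at hf
    obtain ⟨u, hu, ru, hfu, hHu⟩ := hf
    have hsol : ∀ j, H (G.p j) (G.q j) (u j) =ᵐ[edgeMeasure (G.len j)]
        fun x => (r : ℂ) • u j x := fun j => by
      refine (hHu j).symm.trans ((Lp.coeFn_smul (r : ℂ) (f j)).trans ?_)
      exact (hfu j).const_smul _
    have hc := fun j => (h j).exists_eq_smul (G.len_pos j) (G.p_int j) (G.q_int j) (hu j).ac
      (hsol j) (hu j).outer
    choose c hc using hc
    obtain ⟨s, hs⟩ : ∃ s : ℂ, ∀ j, u j 0 0 = s := by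
      rcases isEmpty_or_nonempty (Fin n) with hn | ⟨⟨i⟩⟩
      · exact ⟨0, fun j => hn.elim j⟩
      · exact ⟨u i 0 0, fun j => ru.eq j i⟩
    refine Submodule.mem_span_singleton.2 ⟨s, ?_⟩
    ext1 j
    refine Lp.ext ((Lp.coeFn_smul s _).trans (Filter.EventuallyEq.trans ?_ (hfu j).symm))
    refine ((hLp j).coeFn_toLp.const_smul s).trans ?_
    rw [Filter.EventuallyEq, ae_restrict_iff' measurableSet_Icc]
    refine Filter.Eventually.of_forall fun x hx => ?_
    have hsj := hs j
    rw [hc j 0 ⟨le_rfl, (G.len_pos j).le⟩] at hsj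
    change c j * (φ j r 0 : ℂ) = s at hsj
    have hφ : (φ j r 0 : ℂ) ≠ 0 := Complex.ofReal_ne_zero.2 (hne j)
    rw [hc j x hx, ← hsj]
    change (c j * (φ j r 0 : ℂ)) • (((φ j r 0)⁻¹ : ℝ) : ℂ) • realVec (φ j r) (ψ j r) x = _
    rw [smul_smul, Complex.ofReal_inv, mul_assoc, mul_inv_cancel₀ hφ, mul_one]
  have h2 : (2 : Cardinal) ≤ 1 := le_trans hr hle
  norm_num at h2

/-- The value of `∑ k, f̂_k(v)` prescribed by the Robin condition when `f_j(v) = 1`. -/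
lemma exists_robinMatching {τ : EReal} (hτ : τ ≠ 0) : ∃ t : ℝ, ∀ w : Fin n → C2,
    (∀ j, w j 0 = 1) → ∑ k, w k 1 = (t : ℂ) → RobinMatching τ w := by
  induction τ with
  | bot =>
    exact ⟨0, fun w h1 h2 => ⟨fun i j => by rw [h1, h1], fun t ht => by simp at ht,
      fun _ => by simpa using h2⟩⟩
  | top =>
    exact ⟨0, fun w h1 h2 => ⟨fun i j => by rw [h1, h1], fun t ht => by simp at ht,
      fun _ => by simpa using h2⟩⟩
  | coe s =>
    -- The condition `1 = s * ∑ k, f̂_k(v)` is solvable only for `s ≠ 0`: this is where `τ ≠ 0`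
    -- enters.
    have hs : s ≠ 0 := fun h => hτ (by simp [h])
    refine ⟨s⁻¹, fun w h1 h2 => ⟨fun i j => by rw [h1, h1], fun t ht j => ?_, fun h => ?_⟩⟩
    · rw [h1, h2, ← EReal.coe_injective ht, ← Complex.ofReal_mul, mul_inv_cancel₀ hs,
        Complex.ofReal_one]
    · simp at h

lemma isEigenvalue_of_robinMatching
    (h : ∀ j, OuterFamily (G.p j) (G.q j) (G.len j) (G.α j) (φ j) (ψ j)) {τ : EReal} {r : ℝ}
    (c : Fin n → ℂ) (hc : RobinMatching τ fun j => c j • realVec (φ j r) (ψ j r) 0)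
    {i : Fin n} (hi : c i * φ i r 0 ≠ 0) : (G.T τ).IsEigenvalue r := by
  have hu := fun j => (memMaxDomain_realVec (h j) r).smul (c j)
  have hLp := fun j => memLp_of_ac (G.len_pos j) (hu j).ac
  rw [LinearPMap.IsEigenvalue, Submodule.ne_bot_iff]
  refine ⟨WithLp.toLp 2 fun j => (hLp j).toLp _, ?_, fun h0 => ?_⟩
  · rw [LinearPMap.mem_pointEigenspace_iff, T_graph]
    refine ⟨_, hu, hc, fun j => (hLp j).coeFn_toLp, fun j => ?_⟩
    refine (Lp.coeFn_smul (r : ℂ) _).trans (((hLp j).coeFn_toLp.const_smul (r : ℂ)).trans ?_)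
    refine Filter.EventuallyEq.trans ?_ (H_smul (G.len_pos j) (c j) ((h j).sol r).ac_realVec).symm
    refine Filter.EventuallyEq.trans ?_ (((h j).sol r).H_realVec.const_smul (c j)).symm
    rw [smul_comm]
  -- A continuous representative of the zero class vanishes on the whole closed edge, in particular
  -- at the centre, contrary to `hi`.
  · have hz : (hLp i).toLp _ = 0 := congrArg (fun f : G.L2 => f i) h0
    have hae : c i • realVec (φ i r) (ψ i r) =ᵐ[edgeMeasure (G.len i)] 0 :=
      (hLp i).coeFn_toLp.symm.trans (by rw [hz]; exact Lp.coeFn_zero _ _ _)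
    have hcont := (hu i).ac.continuousOn
    rw [Set.uIcc_of_le (G.len_pos i).le] at hcont
    have heq := Measure.eqOn_Icc_of_ae_eq volume (G.len_pos i).ne hae hcont continuousOn_const
      ⟨le_rfl, (G.len_pos i).le⟩
    exact hi (congrArg (fun v : C2 => v 0) heq)

end DiracKreinStar

theorem corollary5p4 {n : ℕ} (G : DiracKreinStar n) (τ : EReal) (hτ : τ ≠ 0) (a b : ℝ)
    (hab : (G.T τ).AreConsecutiveEigenvalues a b) :
    ¬ ((G.T τ).IsMultipleEigenvalue a ∧ (G.T τ).IsMultipleEigenvalue b) := by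
  rintro ⟨ha, hb⟩
  choose φ ψ h using fun j =>
    DiracKrein.exists_outerFamily (G.len_pos j).le (G.p_int j) (G.q_int j) (G.α j)
  obtain ⟨t, ht⟩ := DiracKreinStar.exists_robinMatching (n := n) hτ
  have ha' := DiracKreinStar.exists_fst_eq_zero_of_isMultipleEigenvalue h ha
  obtain ⟨c, hc, hne, hsum⟩ := DiracKrein.exists_sum_div_eq (φ := fun j r => φ j r 0)
    (ψ := fun j r => ψ j r 0)
    (fun j => (h j).continuous_fst_zero (G.len_pos j).le)
    (fun j => (h j).continuous_snd_zero (G.len_pos j).le)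
    (fun j r => (h j).eventually_ne_zero (G.len_pos j) r)
    (fun j r h0 => (h j).tendsto_div_of_fst_eq_zero (G.len_pos j) (G.p_int j) (G.q_int j) h0)
    hab.lt ha' (DiracKreinStar.exists_fst_eq_zero_of_isMultipleEigenvalue h hb) t
  refine hab.between c hc.1 hc.2 ?_
  obtain ⟨i, -⟩ := ha'
  have hne' : ∀ j, (φ j c 0 : ℂ) ≠ 0 := fun j => Complex.ofReal_ne_zero.2 (hne j)
  -- Dividing by `φ j c 0` makes every first component at the centre equal to `1`, and the second
  -- components become the Weyl functions, whose sum at `c` is `t`.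
  refine DiracKreinStar.isEigenvalue_of_robinMatching h (fun j => (φ j c 0 : ℂ)⁻¹) (ht _ (fun j => ?_) ?_)
    (i := i) ?_
  · exact inv_mul_cancel₀ (hne' j)
  · rw [← hsum]
    push_cast
    refine Finset.sum_congr rfl fun j _ => ?_
    rw [div_eq_inv_mul]
    rfl
  · rw [inv_mul_cancel₀ (hne' i)]
    exact one_ne_zero
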